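/- Let $(n_k)_{k\ge1}$ be a sequence of pairwise distinct integers and $E=\{n_k:k\ge1\}$. Let $\mathrm e_m(z)=z^m$ on the circle $\mathbb T$, let $\mathcal C_E(\mathbb T)$ be the space of continuous functions $f:\mathbb T\to\mathbb C$ with $\widehat f(m)=0$ for all $m\in\mathbb Z\setminus E$, with the sup norm, and let $\pi_kf=\sum_{i\le k}\widehat f(n_i)\,\mathrm e_{n_i}$ be the natural projections. An approximating sequence of a separable Banach space $X$ is a sequence $(T_k)_{k\ge1}$ of bounded finite rank operators on $X$ with $T_kx\to x$ for all $x\in X$. The space $X$ has the metric $\ell_1$-additive approximation property if for each $\varepsilon>0$ there is an approximating sequence $(T_k)$ such that, with $T_0=0$, $$(1+\varepsilon)^{-1}\|x\|\le\sum_{k\ge1}\|T_kx-T_{k-1}x\|\le(1+\varepsilon)\|x\|\qquad\text{for all }x\in X.$$ An approximating sequence $(T_k)$ realizes this property if $\|x-T_kx\|+\|T_kx\|\to1$ as $k\to\infty$, uniformly for $x$ in the unit sphere of $X$. The Sidon constant of $S\subseteq\mathbb Z$ is the infimum of the $C$ such that $\sum_{q\in G}|a_q|\le C\,\bigl\|\sum_{q\in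 G}a_q\mathrm e_q\bigr\|_\infty$ for all finite $G\subseteq S$ and all $a_q\in\mathbb C$, and $S$ is a Sidon set if there is such a $C$. A Sidon set $E$ has constant asymptotically $1$ if for each $\varepsilon>0$ there is a finite set $F$ such that the Sidon constant of $E\setminus F$ is less than $1+\varepsilon$. **Theorem.** (1) If $|n_{k+1}/n_k|\to\infty$, then $\mathcal C_E(\mathbb T)$ has the metric $\ell_1$-additive approximation property, the sequence $(\pi_k)$ is an approximating sequence of $\mathcal C_E(\mathbb T)$ that realizes it, and $E$ is a Sidon set with constant asymptotically $1$. (2) Suppose that all $n_k$ are nonzero and all ratios $n_{k+1}/n_k$ are integers. Then the converse holds: if $(\pi_k)$ is an approximating sequence of $\mathcal C_E(\mathbb T)$ that realizes the metric $\ell_1$-additive approximation property, or if $E$ is a Sidon set with constant asymptotically $1$, then $|n_{k+1}/n_k|\to\infty$. -/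

import Mathlib

open Filter Topology
open scoped ENNReal NNReal

/-! The circle group is realized as `UnitAddCircle = ℝ/ℤ`, through `t ↦ exp (2πit)`; the character
`e_n : z ↦ z ^ n` is then `fourier n`, and `C(UnitAddCircle, ℂ)` carries the sup norm. -/

/-- The `m`-th Fourier coefficient, as a continuous linear functional on `C(𝕋)`. -/
noncomputable def fourierCoeffCLM (m : ℤ) : C(UnitAddCircle, ℂ) →L[ℂ] ℂ :=
  LinearMap.mkContinuous
    { toFun := fun f => fourierCoeff f m
      map_add' := fun f g => by
        have hf := f.continuous.integrable_of_hasCompactSupport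
          (μ := AddCircle.haarAddCircle) (HasCompactSupport.of_compactSpace f)
        have hg := g.continuous.integrable_of_hasCompactSupport
          (μ := AddCircle.haarAddCircle) (HasCompactSupport.of_compactSpace g)
        rw [ContinuousMap.coe_add, fourierCoeff.add hf hg, Pi.add_apply]
      map_smul' := fun c f => by
        rw [ContinuousMap.coe_smul]
        exact fourierCoeff.const_smul f c m } 1 <| fun f => by
    simp only [LinearMap.coe_mk, AddHom.coe_mk, one_mul, fourierCoeff]
    refine (MeasureTheory.norm_integral_le_of_norm_le_const (C := ‖f‖)
      (Eventually.of_forall fun t => ?_)).trans ?_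
    · rw [norm_smul, fourier_apply, Circle.norm_coe, one_mul]
      exact f.norm_coe_le_norm t
    · simp

theorem fourierCoeffCLM_apply (m : ℤ) (f : C(UnitAddCircle, ℂ)) :
    fourierCoeffCLM m f = fourierCoeff f m := rfl

/-- `C_E(𝕋)`: the continuous functions whose Fourier transform vanishes off `E`. -/
noncomputable def spectralSubspace (E : Set ℤ) : Submodule ℂ C(UnitAddCircle, ℂ) where
  carrier := {f | ∀ m ∉ E, fourierCoeff f m = 0}
  zero_mem' := fun m _ => by
    rw [← fourierCoeffCLM_apply, map_zero]
  add_mem' := fun {f g} hf hg m hm => by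
    rw [← fourierCoeffCLM_apply, map_add, fourierCoeffCLM_apply, fourierCoeffCLM_apply,
      hf m hm, hg m hm, add_zero]
  smul_mem' := fun c f hf m hm => by
    rw [← fourierCoeffCLM_apply, map_smul, fourierCoeffCLM_apply, hf m hm, smul_zero]

theorem fourier_mem_spectralSubspace {E : Set ℤ} {m : ℤ} (hm : m ∈ E) :
    (fourier m : C(UnitAddCircle, ℂ)) ∈ spectralSubspace E := fun j hj => by
  rw [fourierCoeff_fourier, Pi.single_eq_of_ne]
  rintro rfl
  exact hj hm

/-- `C_E(𝕋)` as a normed space, with the norm `‖·‖_∞` of `C(𝕋)`. -/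
def ContinuousWithSpectrum (E : Set ℤ) : Type := spectralSubspace E

namespace ContinuousWithSpectrum

noncomputable instance (E : Set ℤ) : NormedAddCommGroup (ContinuousWithSpectrum E) :=
  inferInstanceAs (NormedAddCommGroup (spectralSubspace E))

noncomputable instance (E : Set ℤ) : NormedSpace ℂ (ContinuousWithSpectrum E) :=
  inferInstanceAs (NormedSpace ℂ (spectralSubspace E))

/-- The isometric inclusion of `C_E(𝕋)` into `C(𝕋)`. -/
noncomputable def incl (E : Set ℤ) : ContinuousWithSpectrum E →ₗᵢ[ℂ] C(UnitAddCircle, ℂ) :=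
  (spectralSubspace E).subtypeₗᵢ

/-- The character `e_m`, as an element of `C_E(𝕋)`, for `m ∈ E`. -/
noncomputable def char {E : Set ℤ} (m : ℤ) (hm : m ∈ E) : ContinuousWithSpectrum E :=
  (⟨fourier m, fourier_mem_spectralSubspace hm⟩ : spectralSubspace E)

theorem incl_char {E : Set ℤ} (m : ℤ) (hm : m ∈ E) : incl E (char m hm) = fourier m := rfl

theorem range_incl (E : Set ℤ) :
    Set.range (incl E) = {f : C(UnitAddCircle, ℂ) | ∀ m ∉ E, fourierCoeff f m = 0} :=
  Subtype.range_coe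

end ContinuousWithSpectrum

open ContinuousWithSpectrum in
/-- For `E = {n 0, n 1, …}`, the natural projection of `C_E(𝕋)` onto the span of the first `k + 1`
characters: `f ↦ ∑_{i ≤ k} f̂(n i) e_{n i}`. (Sequences are indexed from `0`.) -/
noncomputable def naturalProj (n : ℕ → ℤ) (k : ℕ) :
    ContinuousWithSpectrum (Set.range n) →L[ℂ] ContinuousWithSpectrum (Set.range n) :=
  ∑ i ∈ Finset.range (k + 1),
    ((fourierCoeffCLM (n i)).comp (incl (Set.range n)).toContinuousLinearMap).smulRight
      (char (n i) (Set.mem_range_self i))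

open ContinuousWithSpectrum in
theorem incl_naturalProj_apply (n : ℕ → ℤ) (k : ℕ) (f : ContinuousWithSpectrum (Set.range n)) :
    incl (Set.range n) (naturalProj n k f) =
      ∑ i ∈ Finset.range (k + 1),
        fourierCoeff (incl (Set.range n) f) (n i) • (fourier (n i) : C(UnitAddCircle, ℂ)) := by
  simp [naturalProj, fourierCoeffCLM_apply, incl_char]

/-- An approximating sequence: finite rank operators that tend strongly to the identity. -/
def IsApproximatingSequence {X : Type*} [NormedAddCommGroup X] [NormedSpace ℂ X]
    (T : ℕ → X →L[ℂ] X) : Prop :=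
  (∀ k, FiniteDimensional ℂ (T k).range) ∧ ∀ x, Tendsto (fun k => T k x) atTop (𝓝 x)

/-- The difference sequence `ΔT_k = T_k - T_{k-1}`, where the term before the first one is `0`. -/
def diffSeq {X : Type*} [NormedAddCommGroup X] [NormedSpace ℂ X]
    (T : ℕ → X →L[ℂ] X) : ℕ → X →L[ℂ] X
  | 0 => T 0
  | k + 1 => T (k + 1) - T k

/-- The `ℓ₁`-additive approximation property with constant `C`:
`C⁻¹ ‖x‖ ≤ ∑ ‖ΔT_k x‖ ≤ C ‖x‖` for some approximating sequence `T`. -/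
def HasOneAdditiveAP (X : Type*) [NormedAddCommGroup X] [NormedSpace ℂ X] (C : ℝ) : Prop :=
  ∃ T : ℕ → X →L[ℂ] X, IsApproximatingSequence T ∧
    ∀ x, Summable (fun k => ‖diffSeq T k x‖) ∧
      C⁻¹ * ‖x‖ ≤ ∑' k, ‖diffSeq T k x‖ ∧ ∑' k, ‖diffSeq T k x‖ ≤ C * ‖x‖

/-- The metric `ℓ₁`-additive approximation property. -/
def HasMetricOneAdditiveAP (X : Type*) [NormedAddCommGroup X] [NormedSpace ℂ X] : Prop :=
  ∀ ε : ℝ, 0 < ε → HasOneAdditiveAP X (1 + ε)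

/-- The sequence `T` realizes the metric `ℓ₁`-additive approximation property: it is an
approximating sequence and `‖x - T_k x‖ + ‖T_k x‖ → 1` uniformly on the unit sphere. -/
def RealizesMetricOneAdditiveAP {X : Type*} [NormedAddCommGroup X] [NormedSpace ℂ X]
    (T : ℕ → X →L[ℂ] X) : Prop :=
  IsApproximatingSequence T ∧
    TendstoUniformlyOn (fun k x => ‖x - T k x‖ + ‖T k x‖) (fun _ => (1 : ℝ)) atTop
      (Metric.sphere (0 : X) 1)

/-- `∑_{q ∈ G} |a_q| ≤ C ‖∑_{q ∈ G} a_q e_q‖_∞` for all finite `G ⊆ E` and coefficients `a_q`. -/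
def SidonBound (E : Set ℤ) (C : ℝ) : Prop :=
  ∀ (G : Finset ℤ) (a : ℤ → ℂ), (G : Set ℤ) ⊆ E →
    ∑ q ∈ G, ‖a q‖ ≤ C * ‖∑ q ∈ G, a q • (fourier q : C(UnitAddCircle, ℂ))‖

/-- The Sidon constant of `E`, `∞` if `E` is not a Sidon set. -/
noncomputable def sidonConstant (E : Set ℤ) : ℝ≥0∞ :=
  ⨅ (C : ℝ≥0) (_ : SidonBound E C), (C : ℝ≥0∞)

/-- `E` is a Sidon set. -/
def IsSidonSet (E : Set ℤ) : Prop := ∃ C : ℝ, SidonBound E C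

/-- `E` is a Sidon set with constant asymptotically `1`: for each `ε > 0` some finite set can be
removed from `E` so that the rest has Sidon constant less than `1 + ε`. -/
def IsSidonAsymptoticallyOne (E : Set ℤ) : Prop :=
  IsSidonSet E ∧
    ∀ ε : ℝ≥0, 0 < ε → ∃ F : Finset ℤ, sidonConstant (E \ (F : Set ℤ)) < 1 + (ε : ℝ≥0∞)

/-! Direct part. When the ratios tend to infinity in modulus, a late frequency dwarfs the sum of all
earlier ones, so its character runs through every phase while the earlier characters hardly move.
Start at a point where the head `g` (the terms of index below `k`) attains its norm, and shift the
point successively so that term `k`, then `k + 1`, ... takes the phase of `g`. Later shifts are so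
small that earlier alignments survive up to a factor `4πδ`. Hence `‖g‖ + ∑_{i ≥ k} |a_i| ≤ (1 + ε)
‖f‖` (`DominatesFrom.norm_add_sum_le`). Trigonometric polynomials are dense, so this passes to all
of `C_E(𝕋)` (`exists_norm_partialSum_add_sum_le`), and the three conclusions of the direct part
follow from this inequality.

Converse. If bounded integer ratios recur, some ratio `l ≠ 1` occurs infinitely often. For a
unimodular `c` with `c ^ (l - 1) = -1`, the polynomials `e_q + e_{lq} + c (e_r + e_{lr})` have norm
at most some `M < 4`, uniformly in `q` and `r` (`exists_norm_two_pairs_le`). Two such pairs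
arbitrarily far out contradict both near additivity of the norm under the projections, where each
pair has norm 2, and a Sidon constant near 1, where the coefficient sum is 4. -/

/-! ### Phase alignment for lacunary polynomials -/

theorem norm_fourier_coe_sub_le (m : ℤ) (s t : ℝ) :
    ‖fourier m (t : UnitAddCircle) - fourier m (s : UnitAddCircle)‖ ≤
      2 * Real.pi * |(m : ℝ)| * |t - s| := by
  have h : fourier m (t : UnitAddCircle) - fourier m (s : UnitAddCircle) =
      fourier m (s : UnitAddCircle) *
        (Complex.exp (Complex.I * ((2 * Real.pi * m * (t - s) : ℝ) : ℂ)) - 1) := by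
    rw [fourier_coe_apply, fourier_coe_apply, mul_sub, ← Complex.exp_add, mul_one]
    congr 2
    push_cast
    ring
  have h1 : ‖fourier m (s : UnitAddCircle)‖ = 1 := by
    rw [fourier_apply, Circle.norm_coe]
  rw [h, norm_mul, h1, one_mul]
  refine Real.norm_exp_I_mul_ofReal_sub_one_le.trans (le_of_eq ?_)
  rw [Real.norm_eq_abs, abs_mul, abs_mul, abs_of_pos Real.two_pi_pos]

/-- The character `e_m` has period `1 / |m|`, so each phase recurs at that distance. -/
theorem exists_near_mul_fourier_eq {m : ℤ} (hm : m ≠ 0) (a u : ℂ) (hu : ‖u‖ = 1) (t₀ : ℝ) :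
    ∃ s : ℝ, |s - t₀| ≤ |(m : ℝ)|⁻¹ ∧ a * fourier m (s : UnitAddCircle) = u * (‖a‖ : ℂ) := by
  rcases eq_or_ne a 0 with rfl | ha
  · exact ⟨t₀, by simp, by simp⟩
  have ha' : (‖a‖ : ℂ) ≠ 0 := by simpa using ha
  have hmR : (m : ℝ) ≠ 0 := by exact_mod_cast hm
  have hw : ‖u * ‖a‖ / a‖ = 1 := by simp [hu, ha]
  set w : ℂ := u * ‖a‖ / a with hwdef
  set x : ℝ := w.arg / (2 * Real.pi) with hx
  have hexp : Complex.exp (2 * Real.pi * Complex.I * x) = w := by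
    have h := Complex.norm_mul_exp_arg_mul_I w
    rw [hw, Complex.ofReal_one, one_mul] at h
    have harg : 2 * Real.pi * Complex.I * x = w.arg * Complex.I := by
      rw [hx]
      push_cast
      field_simp
    rw [harg, h]
  -- The solutions are `(x + j) / m` with `j` an integer; rounding selects one nearest to `t₀`.
  refine ⟨(x + round (m * t₀ - x)) / m, ?_, ?_⟩
  · have h := abs_sub_round (m * t₀ - x)
    have h2 : (x + round (m * t₀ - x)) / m - t₀ =
        -(m * t₀ - x - round (m * t₀ - x)) / m := by field_simp; ring
    rw [h2, abs_div, abs_neg, div_eq_mul_inv]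
    exact mul_le_of_le_one_left (by positivity) (by linarith)
  · have hmC : (m : ℂ) ≠ 0 := by exact_mod_cast hm
    have h2 : fourier m (((x + round (m * t₀ - x)) / m : ℝ) : UnitAddCircle) = w := by
      rw [fourier_coe_apply, ← hexp, Complex.exp_eq_exp_iff_exists_int]
      refine ⟨round (m * t₀ - x), ?_⟩
      push_cast
      field_simp
    rw [h2, hwdef]
    field_simp

/-- Every frequency from the `k`-th on is nonzero and dominates all the earlier ones. -/
def DominatesFrom (n : ℕ → ℤ) (δ : ℝ) (k : ℕ) : Prop :=
  ∀ j, k ≤ j → n j ≠ 0 ∧ ∑ i ∈ Finset.range j, |(n i : ℝ)| ≤ δ * |(n j : ℝ)|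

theorem DominatesFrom.mono {n : ℕ → ℤ} {δ : ℝ} {k l : ℕ} (h : DominatesFrom n δ k) (hkl : k ≤ l) :
    DominatesFrom n δ l := fun j hj => h j (hkl.trans hj)

theorem DominatesFrom.inv_le {n : ℕ → ℤ} {δ : ℝ} {k i j : ℕ} (h : DominatesFrom n δ k)
    (hki : k ≤ i) (hij : i < j) : |(n j : ℝ)|⁻¹ ≤ δ * |(n i : ℝ)|⁻¹ := by
  have hi : 0 < |(n i : ℝ)| := by simpa using (h i hki).1
  have hj : 0 < |(n j : ℝ)| := by simpa using (h j (hki.trans hij.le)).1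
  have h1 : |(n i : ℝ)| ≤ δ * |(n j : ℝ)| :=
    (Finset.single_le_sum (f := fun i => |(n i : ℝ)|) (fun _ _ => abs_nonneg _)
      (Finset.mem_range.2 hij)).trans (h j (hki.trans hij.le)).2
  rw [← div_eq_mul_inv, le_div_iff₀ hi, inv_mul_le_iff₀ hj]
  linarith

/-- Near any point there is a point at which all the terms of index at least `k` have nearly
the prescribed phase `u`. -/
theorem DominatesFrom.exists_near_aligned {n : ℕ → ℤ} {δ : ℝ} (hδ : δ ≤ 1 / 2) (a : ℕ → ℂ) (u : ℂ)
    (hu : ‖u‖ = 1) (m : ℕ) : ∀ k, DominatesFrom n δ k → ∀ t₀ : ℝ, ∃ t : ℝ,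
      |t - t₀| ≤ 2 * |(n k : ℝ)|⁻¹ ∧ ∀ i ∈ Finset.Ico k (k + m),
        ‖a i * fourier (n i) (t : UnitAddCircle) - u * (‖a i‖ : ℂ)‖ ≤
          4 * Real.pi * δ * ‖a i‖ := by
  induction m with
  | zero => exact fun k _ t₀ => ⟨t₀, by simp, by simp⟩
  | succ m ih =>
    intro k hk t₀
    -- Term `k` is aligned exactly at `s`. Aligning the others moves the point by at most `2 / |n (k
    -- + 1)| ≤ 2δ / |n k|`: with `δ ≤ 1 / 2` the total move stays below `2 / |n k|`, and term `k` is
    -- disturbed by at most `2π |n k| · 2δ / |n k| = 4πδ`, relative to its modulus.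
    obtain ⟨s, hs, hsa⟩ := exists_near_mul_fourier_eq (hk k le_rfl).1 (a k) u hu t₀
    obtain ⟨t, ht, hta⟩ := ih (k + 1) (hk.mono k.le_succ) s
    have hinv := hk.inv_le le_rfl k.lt_succ_self
    have hpos : 0 < |(n k : ℝ)| := by simpa using (hk k le_rfl).1
    have hnn : 0 ≤ |(n k : ℝ)|⁻¹ := by positivity
    refine ⟨t, ?_, fun i hi => ?_⟩
    · have h1 := abs_sub_le t s t₀
      have h2 : δ * |(n k : ℝ)|⁻¹ ≤ 1 / 2 * |(n k : ℝ)|⁻¹ := by gcongr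
      simp only [Nat.succ_eq_add_one] at hinv
      linarith
    · rw [Finset.mem_Ico] at hi
      rcases hi.1.eq_or_lt with rfl | hlt
      · rw [← hsa, ← mul_sub, norm_mul, mul_comm]
        gcongr
        refine (norm_fourier_coe_sub_le _ _ _).trans ?_
        have h3 : |t - s| ≤ 2 * (δ * |(n k : ℝ)|⁻¹) := ht.trans (by gcongr)
        calc 2 * Real.pi * |(n k : ℝ)| * |t - s|
            ≤ 2 * Real.pi * |(n k : ℝ)| * (2 * (δ * |(n k : ℝ)|⁻¹)) := by
              gcongr
          _ = 4 * Real.pi * δ := by field_simp; ring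
      · exact hta i (Finset.mem_Ico.2 ⟨hlt, by omega⟩)

theorem norm_fourierCoeffCLM_apply_le (m : ℤ) (f : C(UnitAddCircle, ℂ)) :
    ‖fourierCoeffCLM m f‖ ≤ ‖f‖ := by
  have h : ‖fourierCoeffCLM m‖ ≤ 1 := LinearMap.mkContinuous_norm_le _ zero_le_one _
  simpa using (fourierCoeffCLM m).le_of_opNorm_le h f

theorem fourierCoeffCLM_sum_smul_fourier {ι : Type*} [DecidableEq ι] {n : ι → ℤ}
    (hn : Function.Injective n) (s : Finset ι) (a : ι → ℂ) (j : ι) :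
    fourierCoeffCLM (n j) (∑ i ∈ s, a i • (fourier (n i) : C(UnitAddCircle, ℂ))) =
      if j ∈ s then a j else 0 := by
  simp only [map_sum, map_smul, fourierCoeffCLM_apply, fourierCoeff_fourier, Pi.single_apply,
    hn.eq_iff, smul_eq_mul, mul_ite, mul_one, mul_zero, Finset.sum_ite_eq]

theorem norm_coeff_le_norm_sum_fourier {n : ℕ → ℤ} (hn : Function.Injective n) {s : Finset ℕ}
    (a : ℕ → ℂ) {j : ℕ} (hj : j ∈ s) :
    ‖a j‖ ≤ ‖∑ i ∈ s, a i • (fourier (n i) : C(UnitAddCircle, ℂ))‖ := by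
  have h := norm_fourierCoeffCLM_apply_le (n j)
    (∑ i ∈ s, a i • (fourier (n i) : C(UnitAddCircle, ℂ)))
  rwa [fourierCoeffCLM_sum_smul_fourier hn, if_pos hj] at h

/-- The norm of a lacunary sum is nearly additive on its first `k` terms and the single others. -/
theorem DominatesFrom.norm_add_sum_le {n : ℕ → ℤ} (hn : Function.Injective n) {δ : ℝ}
    (hδ : δ ≤ 1 / 2) {k : ℕ} (hk : DominatesFrom n δ k) (a : ℕ → ℂ) (m : ℕ) :
    (1 - 4 * Real.pi * δ) *
      (‖∑ i ∈ Finset.range k, a i • (fourier (n i) : C(UnitAddCircle, ℂ))‖ +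
        ∑ i ∈ Finset.Ico k (k + m), ‖a i‖) ≤
      ‖∑ i ∈ Finset.range (k + m), a i • (fourier (n i) : C(UnitAddCircle, ℂ))‖ := by
  set g : C(UnitAddCircle, ℂ) := ∑ i ∈ Finset.range k, a i • fourier (n i) with hg
  set f : C(UnitAddCircle, ℂ) := ∑ i ∈ Finset.range (k + m), a i • fourier (n i) with hf
  have hfg : f = g + ∑ i ∈ Finset.Ico k (k + m), a i • (fourier (n i) : C(UnitAddCircle, ℂ)) := by
    rw [hf, hg, Finset.sum_range_add_sum_Ico _ (Nat.le_add_right k m)]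
  obtain ⟨x₀, hx₀⟩ : ∃ x₀, ‖g x₀‖ = ‖g‖ := by
    obtain ⟨x₀, -, hx₀⟩ := isCompact_univ.exists_isMaxOn Set.univ_nonempty
      (f := fun x => ‖g x‖) (by fun_prop)
    refine ⟨x₀, (g.norm_coe_le_norm x₀).antisymm ?_⟩
    exact (ContinuousMap.norm_le _ (norm_nonneg _)).2 fun x => hx₀ (Set.mem_univ x)
  obtain ⟨t₀, rfl⟩ := QuotientAddGroup.mk_surjective x₀
  change ‖g (t₀ : UnitAddCircle)‖ = ‖g‖ at hx₀
  obtain ⟨u, hu, hgu⟩ : ∃ u : ℂ, ‖u‖ = 1 ∧ g (t₀ : UnitAddCircle) = u * (‖g‖ : ℂ) := by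
    refine ⟨Complex.exp ((g (t₀ : UnitAddCircle)).arg * Complex.I),
      Complex.norm_exp_ofReal_mul_I _, ?_⟩
    rw [← hx₀, mul_comm, Complex.norm_mul_exp_arg_mul_I]
  obtain ⟨t, ht, hta⟩ := DominatesFrom.exists_near_aligned hδ a u hu m k hk t₀
  have hpos : 0 < |(n k : ℝ)| := by simpa using (hk k le_rfl).1
  -- A crude substitute for Bernstein's inequality: each coefficient of `g` is at most `‖g‖`, and
  -- the frequencies of `g` sum to at most `δ |n k|` in modulus.
  have hgt : ‖g (t : UnitAddCircle) - g (t₀ : UnitAddCircle)‖ ≤ 4 * Real.pi * δ * ‖g‖ := by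
    have happ : ∀ x, g x = ∑ i ∈ Finset.range k, a i * fourier (n i) x := fun x => by
      simp [hg, ContinuousMap.sum_apply]
    rw [happ, happ, ← Finset.sum_sub_distrib]
    calc ‖∑ i ∈ Finset.range k, (a i * fourier (n i) (t : UnitAddCircle) -
            a i * fourier (n i) (t₀ : UnitAddCircle))‖
        ≤ ∑ i ∈ Finset.range k, ‖g‖ *
            (2 * Real.pi * |(n i : ℝ)| * (2 * |(n k : ℝ)|⁻¹)) := by
          refine norm_sum_le_of_le _ fun i hi => ?_
          rw [← mul_sub, norm_mul]
          refine mul_le_mul (norm_coeff_le_norm_sum_fourier hn a hi) ?_ (norm_nonneg _)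
            (norm_nonneg _)
          exact (norm_fourier_coe_sub_le _ _ _).trans (by gcongr)
      _ = (4 * Real.pi * ‖g‖ * |(n k : ℝ)|⁻¹) * ∑ i ∈ Finset.range k, |(n i : ℝ)| := by
          rw [Finset.mul_sum]
          exact Finset.sum_congr rfl fun i _ => by ring
      _ ≤ (4 * Real.pi * ‖g‖ * |(n k : ℝ)|⁻¹) * (δ * |(n k : ℝ)|) := by
          have := (hk k le_rfl).2
          gcongr
      _ = 4 * Real.pi * δ * ‖g‖ := by field_simp
  have hft : f (t : UnitAddCircle) - u * ((‖g‖ + ∑ i ∈ Finset.Ico k (k + m), ‖a i‖ : ℝ) : ℂ) =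
      (g (t : UnitAddCircle) - g (t₀ : UnitAddCircle)) +
        ∑ i ∈ Finset.Ico k (k + m),
          (a i * fourier (n i) (t : UnitAddCircle) - u * (‖a i‖ : ℂ)) := by
    rw [hfg, hgu, Finset.sum_sub_distrib, ← Finset.mul_sum]
    simp only [ContinuousMap.add_apply, ContinuousMap.sum_apply, ContinuousMap.smul_apply,
      smul_eq_mul]
    push_cast
    ring
  have herr := (norm_add_le _ _).trans (add_le_add hgt (norm_sum_le_of_le _ hta))
  rw [← hft, ← Finset.mul_sum] at herr
  have hnorm : ‖u * ((‖g‖ + ∑ i ∈ Finset.Ico k (k + m), ‖a i‖ : ℝ) : ℂ)‖ =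
      ‖g‖ + ∑ i ∈ Finset.Ico k (k + m), ‖a i‖ := by
    rw [norm_mul, hu, one_mul, Complex.norm_real, Real.norm_of_nonneg (by positivity)]
  have h1 := norm_sub_norm_le (u * ((‖g‖ + ∑ i ∈ Finset.Ico k (k + m), ‖a i‖ : ℝ) : ℂ))
    (f (t : UnitAddCircle))
  rw [norm_sub_rev, hnorm] at h1
  have h2 := f.norm_coe_le_norm (t : UnitAddCircle)
  linarith

theorem eventually_dominatesFrom {n : ℕ → ℤ}
    (h : Tendsto (fun k => |(n (k + 1) : ℝ) / (n k : ℝ)|) atTop atTop) {δ : ℝ} (hδ : 0 < δ) :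
    ∃ k, DominatesFrom n δ k := by
  obtain ⟨K, hK⟩ := eventually_atTop.1 (h.eventually_ge_atTop 2)
  have hne : ∀ k, K ≤ k → 0 < |(n k : ℝ)| := fun k hk => by
    -- Division by zero gives `0`, so a vanishing `n k` would contradict a ratio of at least 2.
    refine abs_pos.2 fun h0 => ?_
    have := hK k hk
    rw [h0, div_zero, abs_zero] at this
    linarith
  have hgrow : ∀ c k, K ≤ k → c ≤ |(n (k + 1) : ℝ) / (n k : ℝ)| →
      c * |(n k : ℝ)| ≤ |(n (k + 1) : ℝ)| := fun c k hk hc => by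
    rwa [abs_div, le_div_iff₀ (hne k hk)] at hc
  -- Ratios of at least 2 propagate the bound, since `B / 2 + 1 ≤ B`; a further ratio of at least `B
  -- / δ` then turns the factor `B` into `δ`.
  obtain ⟨B, hB2, hB⟩ : ∃ B : ℝ, 2 ≤ B ∧
      ∀ k, K ≤ k → ∑ i ∈ Finset.range (k + 1), |(n i : ℝ)| ≤ B * |(n k : ℝ)| := by
    refine ⟨max 2 ((∑ i ∈ Finset.range (K + 1), |(n i : ℝ)|) / |(n K : ℝ)|), le_max_left _ _,
      fun k hk => ?_⟩
    set B := max 2 ((∑ i ∈ Finset.range (K + 1), |(n i : ℝ)|) / |(n K : ℝ)|) with hBdef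
    induction k, hk using Nat.le_induction with
    | base => exact (div_le_iff₀ (hne K le_rfl)).1 (le_max_right _ _)
    | succ k hk ih =>
      rw [Finset.sum_range_succ]
      have h2 := hgrow 2 k hk (hK k hk)
      have hB2 : 2 ≤ B := le_max_left _ _
      have h3 := mul_le_mul_of_nonneg_left h2 (by linarith : 0 ≤ B / 2)
      have h4 := mul_le_mul_of_nonneg_right (by linarith : B / 2 + 1 ≤ B)
        (abs_nonneg (n (k + 1) : ℝ))
      linarith
  obtain ⟨L, hL⟩ := eventually_atTop.1 (h.eventually_ge_atTop (B / δ))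
  refine ⟨max K L + 1, fun j hj => ?_⟩
  obtain ⟨k, rfl⟩ : ∃ k, j = k + 1 := ⟨j - 1, by omega⟩
  have hKk : K ≤ k := (le_max_left K L).trans (by omega)
  have hLk : L ≤ k := (le_max_right K L).trans (by omega)
  refine ⟨by simpa using hne (k + 1) (by omega), (hB k hKk).trans ?_⟩
  have h1 := hgrow _ k hKk (hL k hLk)
  rwa [div_mul_eq_mul_div, div_le_iff₀ hδ, mul_comm _ δ] at h1

/-! ### Density of trigonometric polynomials in `C_E(𝕋)` -/

/-- The translation of `f` by `-s`. -/
noncomputable def circleTranslate (f : C(UnitAddCircle, ℂ)) (s : UnitAddCircle) : C(UnitAddCircle, ℂ) :=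
  f.comp ⟨fun t => t - s, by fun_prop⟩

theorem continuous_circleTranslate (f : C(UnitAddCircle, ℂ)) : Continuous (circleTranslate f) := by
  refine ContinuousMap.continuous_of_continuous_uncurry _ ?_
  change Continuous fun p : UnitAddCircle × UnitAddCircle => f (p.2 - p.1)
  fun_prop

theorem integral_fourier_smul_circleTranslate (f : C(UnitAddCircle, ℂ)) (m : ℤ) :
    ∫ s, (fourier m : C(UnitAddCircle, ℂ)) s • circleTranslate f s ∂AddCircle.haarAddCircle =
      fourierCoeff f m • (fourier m : C(UnitAddCircle, ℂ)) := by
  ext t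
  have hint : MeasureTheory.Integrable
      (fun s => (fourier m : C(UnitAddCircle, ℂ)) s • circleTranslate f s) AddCircle.haarAddCircle :=
    (((fourier m).continuous).smul (continuous_circleTranslate f)).integrable_of_hasCompactSupport
      (HasCompactSupport.of_compactSpace _)
  rw [ContinuousMap.integral_apply hint]
  simp only [ContinuousMap.smul_apply, circleTranslate, ContinuousMap.comp_apply, ContinuousMap.coe_mk]
  rw [← MeasureTheory.integral_sub_left_eq_self _ AddCircle.haarAddCircle t]
  simp only [sub_sub_cancel, smul_eq_mul]
  rw [fourierCoeff, ← MeasureTheory.integral_mul_const]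
  refine MeasureTheory.integral_congr_ae (Eventually.of_forall fun s => ?_)
  have h : (fourier m : C(UnitAddCircle, ℂ)) (t - s) = fourier m t * fourier (-m) s := by
    simp [fourier_apply, sub_eq_add_neg, AddCircle.toCircle_add, smul_add]
  simp only [h, smul_eq_mul]
  ring

/-- The peak function `1 + cos (2πt)`, as a trigonometric polynomial. -/
noncomputable def peak : C(UnitAddCircle, ℂ) := fourier 0 + (2⁻¹ : ℂ) • (fourier 1 + fourier (-1))

theorem peak_apply (s : UnitAddCircle) :
    peak s = ((1 + (AddCircle.toCircle s : ℂ).re : ℝ) : ℂ) := by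
  have h := Complex.add_conj (AddCircle.toCircle s : ℂ)
  simp only [peak, ContinuousMap.add_apply, ContinuousMap.smul_apply, fourier_neg, fourier_one,
    fourier_zero, smul_eq_mul, h]
  push_cast
  ring

/-- The integral is the convolution `p * f`. Since `e_m * f = f̂(m) e_m`, only frequencies in `E`
survive. -/
theorem integral_smul_circleTranslate_mem {E : Set ℤ} {f : C(UnitAddCircle, ℂ)}
    (hf : f ∈ spectralSubspace E) {p : C(UnitAddCircle, ℂ)}
    (hp : p ∈ Submodule.span ℂ (Set.range (fourier : ℤ → C(UnitAddCircle, ℂ)))) :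
    ∫ s, p s • circleTranslate f s ∂AddCircle.haarAddCircle ∈
      Submodule.span ℂ ((fourier : ℤ → C(UnitAddCircle, ℂ)) '' E) := by
  have hint : ∀ q : C(UnitAddCircle, ℂ), MeasureTheory.Integrable
      (fun s => q s • circleTranslate f s) AddCircle.haarAddCircle := fun q =>
    (q.continuous.smul (continuous_circleTranslate f)).integrable_of_hasCompactSupport
      (HasCompactSupport.of_compactSpace _)
  induction hp using Submodule.span_induction with
  | mem p hp =>
    obtain ⟨m, rfl⟩ := hp
    rw [integral_fourier_smul_circleTranslate]
    by_cases hm : m ∈ E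
    · exact Submodule.smul_mem _ _ (Submodule.subset_span ⟨m, hm, rfl⟩)
    · rw [hf m hm, show (0 : ℂ) • (fourier m : C(UnitAddCircle, ℂ)) = 0 by ext; simp]
      exact Submodule.zero_mem _
  | zero =>
    have h : ∀ s, (0 : C(UnitAddCircle, ℂ)) s • circleTranslate f s = 0 := fun s => by
      ext; simp
    simp only [h, MeasureTheory.integral_zero]
    exact Submodule.zero_mem _
  | add p q _ _ hp hq =>
    have h : ∀ s, (p + q) s • circleTranslate f s =
        p s • circleTranslate f s + q s • circleTranslate f s := fun s => by ext; simp [add_mul]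
    simp only [h]
    rw [MeasureTheory.integral_add (hint p) (hint q)]
    exact Submodule.add_mem _ hp hq
  | smul c p _ hp =>
    simp only [ContinuousMap.smul_apply, smul_assoc]
    rw [MeasureTheory.integral_smul]
    exact Submodule.smul_mem _ _ hp

/-- Trigonometric polynomials with spectrum in `E` are dense in `C_E(𝕋)`. -/
theorem spectralSubspace_le_closure_span {E : Set ℤ} {f : C(UnitAddCircle, ℂ)}
    (hf : f ∈ spectralSubspace E) :
    f ∈ closure (Submodule.span ℂ ((fourier : ℤ → C(UnitAddCircle, ℂ)) '' E) :
      Set C(UnitAddCircle, ℂ)) := by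
  -- The normalized powers of the peak function concentrate at its unique maximum `0`. Applied to
  -- the `C(𝕋)`-valued map `s ↦ f(· - s)`, this gives uniform convergence of the convolutions to
  -- `f`.
  have hlim := tendsto_setIntegral_pow_smul_of_unique_maximum_of_isCompact_of_continuousOn
    (μ := (AddCircle.haarAddCircle : MeasureTheory.Measure UnitAddCircle)) isCompact_univ
    (c := fun s => 1 + (AddCircle.toCircle s : ℂ).re) (x₀ := 0) (g := circleTranslate f)
    (by fun_prop) ?_ ?_ ?_ (by simp) (continuous_circleTranslate f).continuousOn
  · have h0 : circleTranslate f 0 = f := by ext t; simp [circleTranslate]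
    rw [h0] at hlim
    refine mem_closure_of_tendsto hlim (Eventually.of_forall fun N => ?_)
    have hpow : peak ^ N ∈ Submodule.span ℂ
        (Set.range (fourier : ℤ → C(UnitAddCircle, ℂ))) := by
      have hmem : ∀ m : ℤ, (fourier m : C(UnitAddCircle, ℂ)) ∈ Subalgebra.toSubmodule
          (@fourierSubalgebra 1).toSubalgebra := fun m => by
        rw [fourierSubalgebra_coe]
        exact Submodule.subset_span ⟨m, rfl⟩
      rw [← fourierSubalgebra_coe]
      refine Subalgebra.pow_mem _ ?_ N
      exact add_mem (hmem 0) (Submodule.smul_mem _ _ (add_mem (hmem 1) (hmem (-1))))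
    have h := integral_smul_circleTranslate_mem hf hpow
    rw [MeasureTheory.setIntegral_univ, MeasureTheory.setIntegral_univ]
    have heq : ∀ s, (peak ^ N) s • circleTranslate f s =
        (1 + (AddCircle.toCircle s : ℂ).re) ^ N • circleTranslate f s := fun s => by
      
      rw [ContinuousMap.pow_apply, peak_apply, ← Complex.ofReal_pow]
      ext t
      simp
    simp only [heq] at h
    rw [← Complex.coe_smul]
    exact Submodule.smul_mem _ _ h
  · intro s _ hs
    simp only [AddCircle.toCircle_zero, Circle.coe_one, Complex.one_re, add_lt_add_iff_left]
    refine lt_of_le_of_ne ((Complex.re_le_norm _).trans (Circle.norm_coe _).le) fun h => hs ?_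
    apply AddCircle.injective_toCircle (T := 1) one_ne_zero
    rw [AddCircle.toCircle_zero]
    ext
    have h2 := Complex.re_eq_norm.1 (h.trans (Circle.norm_coe (AddCircle.toCircle s)).symm)
    rw [Circle.coe_one]
    exact Complex.ext h (by simpa using (Complex.nonneg_iff.1 h2).2.symm)
  · intro s _
    have := (abs_le.1 ((Complex.abs_re_le_norm (AddCircle.toCircle s : ℂ)).trans
      (Circle.norm_coe _).le)).1
    linarith
  · simp

/-! ### Near additivity on `C_E(𝕋)` and absolute convergence of Fourier series -/

theorem exists_eq_sum_range_of_mem_span {n : ℕ → ℤ} {p : C(UnitAddCircle, ℂ)}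
    (hp : p ∈ Submodule.span ℂ ((fourier : ℤ → C(UnitAddCircle, ℂ)) '' Set.range n)) :
    ∃ (N : ℕ) (a : ℕ → ℂ), ∀ M, N ≤ M →
      p = ∑ i ∈ Finset.range M, a i • (fourier (n i) : C(UnitAddCircle, ℂ)) := by
  rw [← Set.range_comp, Finsupp.mem_span_range_iff_exists_finsupp] at hp
  obtain ⟨c, rfl⟩ := hp
  refine ⟨c.support.sup id + 1, c, fun M hM => ?_⟩
  refine Finsupp.sum_of_support_subset _ (fun i hi => ?_) _ fun i _ => ?_
  · have : i ≤ c.support.sup id := Finset.le_sup (f := id) hi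
    exact Finset.mem_range.2 (by omega)
  · ext; simp

/-- For fixed `k` and `m` both sides are continuous in `f`, so polynomials suffice. A polynomial may
have terms beyond `k + m`; the bound for all its terms is stronger. -/
theorem DominatesFrom.norm_partialSum_add_sum_le {n : ℕ → ℤ} (hn : Function.Injective n) {δ : ℝ}
    (hδ : 4 * Real.pi * δ ≤ 1) {k : ℕ} (hk : DominatesFrom n δ k) {f : C(UnitAddCircle, ℂ)}
    (hf : f ∈ spectralSubspace (Set.range n)) (m : ℕ) :
    (1 - 4 * Real.pi * δ) *
      (‖∑ i ∈ Finset.range k, fourierCoeffCLM (n i) f • (fourier (n i) : C(UnitAddCircle, ℂ))‖ +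
        ∑ i ∈ Finset.Ico k (k + m), ‖fourierCoeffCLM (n i) f‖) ≤ ‖f‖ := by
  have hδ2 : δ ≤ 1 / 2 := by nlinarith [Real.pi_gt_three]
  have hcl : IsClosed {f : C(UnitAddCircle, ℂ) | (1 - 4 * Real.pi * δ) *
      (‖∑ i ∈ Finset.range k, fourierCoeffCLM (n i) f • (fourier (n i) : C(UnitAddCircle, ℂ))‖ +
        ∑ i ∈ Finset.Ico k (k + m), ‖fourierCoeffCLM (n i) f‖) ≤ ‖f‖} := by
    refine isClosed_le (continuous_const.mul (Continuous.add ?_ ?_)) continuous_norm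
    · exact (continuous_finsetSum _ fun i _ =>
        (fourierCoeffCLM (n i)).continuous.smul continuous_const).norm
    · exact continuous_finsetSum _ fun i _ => (fourierCoeffCLM (n i)).continuous.norm
  refine closure_minimal ?_ hcl (spectralSubspace_le_closure_span hf)
  intro p hp
  obtain ⟨N, a, ha⟩ := exists_eq_sum_range_of_mem_span hp
  have hp := ha (k + (m + N)) (by omega)
  have hcoef : ∀ i < k + (m + N), fourierCoeffCLM (n i) p = a i := fun i hi => by
    rw [hp, fourierCoeffCLM_sum_smul_fourier hn, if_pos (Finset.mem_range.2 hi)]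
  have h := hk.norm_add_sum_le hn hδ2 a (m + N)
  rw [← hp] at h
  refine le_trans (mul_le_mul_of_nonneg_left (add_le_add (le_of_eq ?_) ?_) (by linarith)) h
  · congr 1
    exact Finset.sum_congr rfl fun i hi => by
      rw [hcoef i (by have := Finset.mem_range.1 hi; omega)]
  · rw [Finset.sum_congr rfl fun i hi => by
      rw [hcoef i (by have := (Finset.mem_Ico.1 hi).2; omega)]]
    exact Finset.sum_le_sum_of_subset_of_nonneg
      (Finset.Ico_subset_Ico le_rfl (by omega)) fun _ _ _ => norm_nonneg _

/-- Along a lacunary sequence, the norm is nearly additive from some index on. -/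
theorem exists_norm_partialSum_add_sum_le {n : ℕ → ℤ} (hn : Function.Injective n)
    (h : Tendsto (fun k => |(n (k + 1) : ℝ) / (n k : ℝ)|) atTop atTop) {ε : ℝ} (hε : 0 < ε) :
    ∃ K, ∀ k, K ≤ k → ∀ f ∈ spectralSubspace (Set.range n), ∀ m,
      ‖∑ i ∈ Finset.range k, fourierCoeffCLM (n i) f • (fourier (n i) : C(UnitAddCircle, ℂ))‖ +
        ∑ i ∈ Finset.Ico k (k + m), ‖fourierCoeffCLM (n i) f‖ ≤ (1 + ε) * ‖f‖ := by
  have hπ := Real.pi_pos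
  -- This `δ` solves `1 - 4πδ = (1 + ε)⁻¹`.
  have hδ : 0 < ε / (4 * Real.pi * (1 + ε)) := by positivity
  obtain ⟨K, hK⟩ := eventually_dominatesFrom h hδ
  have h1 : 1 - 4 * Real.pi * (ε / (4 * Real.pi * (1 + ε))) = (1 + ε)⁻¹ := by
    field_simp
    ring
  refine ⟨K, fun k hk f hf m => ?_⟩
  have h2 : 0 < (1 + ε)⁻¹ := by positivity
  have h3 := (hK.mono hk).norm_partialSum_add_sum_le hn (by linarith) hf m
  rwa [h1, inv_mul_le_iff₀ (by positivity)] at h3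

theorem summable_norm_fourierCoeff {n : ℕ → ℤ} (hn : Function.Injective n)
    (h : Tendsto (fun k => |(n (k + 1) : ℝ) / (n k : ℝ)|) atTop atTop) {f : C(UnitAddCircle, ℂ)}
    (hf : f ∈ spectralSubspace (Set.range n)) : Summable fun i => ‖fourierCoeffCLM (n i) f‖ := by
  obtain ⟨K, hK⟩ := exists_norm_partialSum_add_sum_le hn h one_pos
  rw [← summable_nat_add_iff K]
  refine summable_of_sum_range_le (c := (1 + 1) * ‖f‖) (fun _ => norm_nonneg _) fun m => ?_
  have h1 := hK K le_rfl f hf m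
  rw [Finset.sum_Ico_eq_sum_range, Nat.add_sub_cancel_left] at h1
  simp only [add_comm _ K]
  exact (le_add_of_nonneg_left (norm_nonneg _)).trans h1

theorem hasSum_fourierCoeff_smul {n : ℕ → ℤ} (hn : Function.Injective n)
    (h : Tendsto (fun k => |(n (k + 1) : ℝ) / (n k : ℝ)|) atTop atTop) {f : C(UnitAddCircle, ℂ)}
    (hf : f ∈ spectralSubspace (Set.range n)) :
    HasSum (fun i => fourierCoeffCLM (n i) f • (fourier (n i) : C(UnitAddCircle, ℂ))) f := by
  have hsum : Summable (fourierCoeff f) := by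
    rw [← hn.summable_iff hf]
    exact (summable_norm_fourierCoeff hn h hf).of_norm
  refine (hn.hasSum_iff fun m hm => ?_).2 (hasSum_fourier_series_of_summable hsum)
  rw [hf m hm]
  ext
  simp

/-! ### Consequences for the natural projections -/

section

open ContinuousWithSpectrum

theorem incl_mem_spectralSubspace {E : Set ℤ} (x : ContinuousWithSpectrum E) :
    incl E x ∈ spectralSubspace E :=
  Subtype.prop (p := fun f => f ∈ spectralSubspace E) x

theorem exists_norm_naturalProj_add_tsum_le {n : ℕ → ℤ} (hn : Function.Injective n)
    (h : Tendsto (fun k => |(n (k + 1) : ℝ) / (n k : ℝ)|) atTop atTop) {ε : ℝ} (hε : 0 < ε) :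
    ∃ K, ∀ k, K ≤ k → ∀ x : ContinuousWithSpectrum (Set.range n),
      ‖naturalProj n k x‖ + ∑' i, ‖fourierCoeffCLM (n (i + (k + 1))) (incl (Set.range n) x)‖ ≤
        (1 + ε) * ‖x‖ := by
  obtain ⟨K, hK⟩ := exists_norm_partialSum_add_sum_le hn h hε
  refine ⟨K, fun k hk x => ?_⟩
  have h1 := hK (k + 1) (by omega) _ (incl_mem_spectralSubspace x)
  rw [← (incl (Set.range n)).norm_map (naturalProj n k x), incl_naturalProj_apply,
    ← (incl (Set.range n)).norm_map x, ← le_sub_iff_add_le']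
  have hs := (summable_nat_add_iff (k + 1)).2
    (summable_norm_fourierCoeff hn h (incl_mem_spectralSubspace x))
  refine hs.tsum_le_of_sum_range_le fun m => ?_
  have h2 := h1 m
  rw [Finset.sum_Ico_eq_sum_range, Nat.add_sub_cancel_left] at h2
  simp only [add_comm _ (k + 1)]
  exact le_sub_iff_add_le'.2 h2

theorem tendsto_naturalProj {n : ℕ → ℤ} (hn : Function.Injective n)
    (h : Tendsto (fun k => |(n (k + 1) : ℝ) / (n k : ℝ)|) atTop atTop)
    (x : ContinuousWithSpectrum (Set.range n)) :
    Tendsto (fun k => naturalProj n k x) atTop (𝓝 x) := by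
  rw [(incl (Set.range n)).isometry.isEmbedding.tendsto_nhds_iff]
  have h1 := (hasSum_fourierCoeff_smul hn h (incl_mem_spectralSubspace x)).tendsto_sum_nat
  refine ((tendsto_add_atTop_iff_nat 1).2 h1).congr fun k => ?_
  exact (incl_naturalProj_apply n k x).symm

theorem norm_sub_naturalProj_le_tsum {n : ℕ → ℤ} (hn : Function.Injective n)
    (h : Tendsto (fun k => |(n (k + 1) : ℝ) / (n k : ℝ)|) atTop atTop) (k : ℕ)
    (x : ContinuousWithSpectrum (Set.range n)) :
    ‖x - naturalProj n k x‖ ≤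
      ∑' i, ‖fourierCoeffCLM (n (i + (k + 1))) (incl (Set.range n) x)‖ := by
  have hs := (summable_nat_add_iff (k + 1)).2
    (summable_norm_fourierCoeff hn h (incl_mem_spectralSubspace x))
  have h1 := (hasSum_nat_add_iff' (k + 1)).2
    (hasSum_fourierCoeff_smul hn h (incl_mem_spectralSubspace x))
  rw [← (incl (Set.range n)).norm_map, map_sub, incl_naturalProj_apply]
  refine h1.norm_le_of_bounded hs.hasSum fun i => ?_
  rw [norm_smul, fourier_norm, mul_one]

theorem finiteDimensional_range_naturalProj (n : ℕ → ℤ) (k : ℕ) :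
    FiniteDimensional ℂ (naturalProj n k).range := by
  have hle : (naturalProj n k).range ≤ Submodule.span ℂ (Set.range fun i : Fin (k + 1) =>
      (char (n i) (Set.mem_range_self _) : ContinuousWithSpectrum (Set.range n))) := by
    rintro _ ⟨x, rfl⟩
    simp only [naturalProj, ContinuousLinearMap.coe_coe, sum_apply,
      ContinuousLinearMap.smulRight_apply]
    refine Submodule.sum_mem _ fun i hi => Submodule.smul_mem _ _ (Submodule.subset_span ?_)
    exact ⟨⟨i, Finset.mem_range.1 hi⟩, rfl⟩
  have := FiniteDimensional.span_of_finite ℂ (Set.finite_range fun i : Fin (k + 1) =>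
      (char (n i) (Set.mem_range_self _) : ContinuousWithSpectrum (Set.range n)))
  exact Submodule.finiteDimensional_of_le hle

theorem isApproximatingSequence_naturalProj {n : ℕ → ℤ} (hn : Function.Injective n)
    (h : Tendsto (fun k => |(n (k + 1) : ℝ) / (n k : ℝ)|) atTop atTop) :
    IsApproximatingSequence (naturalProj n) :=
  ⟨finiteDimensional_range_naturalProj n, tendsto_naturalProj hn h⟩

/-- The lower bound `1` is the triangle inequality; for the upper bound, `‖x - π_k x‖` is at most
the `ℓ₁` norm of the remaining coefficients. -/
theorem realizesMetricOneAdditiveAP_naturalProj {n : ℕ → ℤ} (hn : Function.Injective n)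
    (h : Tendsto (fun k => |(n (k + 1) : ℝ) / (n k : ℝ)|) atTop atTop) :
    RealizesMetricOneAdditiveAP (naturalProj n) := by
  refine ⟨isApproximatingSequence_naturalProj hn h, ?_⟩
  rw [Metric.tendstoUniformlyOn_iff]
  intro ε hε
  obtain ⟨K, hK⟩ := exists_norm_naturalProj_add_tsum_le hn h (half_pos hε)
  filter_upwards [eventually_ge_atTop K] with k hk x hx
  rw [mem_sphere_zero_iff_norm] at hx
  have h1 := hK k hk x
  have h2 := norm_sub_naturalProj_le_tsum hn h k x
  have h3 : ‖x‖ ≤ ‖x - naturalProj n k x‖ + ‖naturalProj n k x‖ := by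
    simpa using norm_add_le (x - naturalProj n k x) (naturalProj n k x)
  rw [hx] at h1 h3
  rw [dist_comm, Real.dist_eq, abs_of_nonneg (by linarith)]
  linarith

theorem norm_diffSeq_naturalProj_succ (n : ℕ → ℤ) (K j : ℕ)
    (x : ContinuousWithSpectrum (Set.range n)) :
    ‖diffSeq (fun j => naturalProj n (j + K)) (j + 1) x‖ =
      ‖fourierCoeffCLM (n (j + (K + 1))) (incl (Set.range n) x)‖ := by
  rw [← (incl (Set.range n)).norm_map]
  simp only [diffSeq, sub_apply, map_sub, incl_naturalProj_apply]
  rw [show j + 1 + K = j + K + 1 by omega, Finset.sum_range_succ _ (j + K + 1),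
    add_sub_cancel_left, norm_smul, fourier_norm, mul_one, fourierCoeffCLM_apply, add_assoc]

theorem sum_range_diffSeq {X : Type*} [NormedAddCommGroup X] [NormedSpace ℂ X]
    (T : ℕ → X →L[ℂ] X) (x : X) (k : ℕ) :
    ∑ j ∈ Finset.range (k + 1), diffSeq T j x = T k x := by
  induction k with
  | zero => simp [diffSeq]
  | succ k ih => rw [Finset.sum_range_succ, ih, diffSeq, sub_apply]; abel

theorem norm_le_tsum_norm_diffSeq {X : Type*} [NormedAddCommGroup X] [NormedSpace ℂ X]
    {T : ℕ → X →L[ℂ] X} {x : X} (hT : Tendsto (fun k => T k x) atTop (𝓝 x))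
    (hs : Summable fun k => ‖diffSeq T k x‖) : ‖x‖ ≤ ∑' k, ‖diffSeq T k x‖ := by
  refine le_of_tendsto hT.norm (Eventually.of_forall fun k => ?_)
  rw [← sum_range_diffSeq]
  exact (norm_sum_le _ _).trans (hs.sum_le_tsum _ fun _ _ => norm_nonneg _)

theorem hasMetricOneAdditiveAP {n : ℕ → ℤ} (hn : Function.Injective n)
    (h : Tendsto (fun k => |(n (k + 1) : ℝ) / (n k : ℝ)|) atTop atTop) :
    HasMetricOneAdditiveAP (ContinuousWithSpectrum (Set.range n)) := by
  intro ε hε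
  obtain ⟨K, hK⟩ := exists_norm_naturalProj_add_tsum_le hn h hε
  have htend : ∀ x, Tendsto (fun j => naturalProj n (j + K) x) atTop (𝓝 x) := fun x =>
    (tendsto_add_atTop_iff_nat K).2 (tendsto_naturalProj hn h x)
  -- Starting at `K` makes the whole head the first difference; every later difference is a single
  -- term. Their norms sum to exactly the quantity bounded by `hK`.
  refine ⟨fun j => naturalProj n (j + K),
    ⟨fun k => finiteDimensional_range_naturalProj n _, htend⟩, fun x => ?_⟩
  have hs : Summable fun j => ‖diffSeq (fun j => naturalProj n (j + K)) j x‖ := by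
    have hc := (summable_nat_add_iff (K + 1)).2
      (summable_norm_fourierCoeff hn h (incl_mem_spectralSubspace x))
    rw [← summable_nat_add_iff 1]
    exact hc.congr fun j => (norm_diffSeq_naturalProj_succ n K j x).symm
  refine ⟨hs, ?_, ?_⟩
  · refine le_trans ?_ (norm_le_tsum_norm_diffSeq (htend x) hs)
    exact mul_le_of_le_one_left (norm_nonneg _) (inv_le_one_of_one_le₀ (by linarith))
  · rw [hs.tsum_eq_zero_add, tsum_congr fun j => norm_diffSeq_naturalProj_succ n K j x]
    simpa only [diffSeq, zero_add] using hK K le_rfl x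

/-! ### Sidon constants -/

theorem sidonBound_of_sum_Ico_le {n : ℕ → ℤ} (hn : Function.Injective n) {k : ℕ} {C : ℝ}
    (hC : ∀ f ∈ spectralSubspace (Set.range n), ∀ m,
      ∑ i ∈ Finset.Ico k (k + m), ‖fourierCoeffCLM (n i) f‖ ≤ C * ‖f‖) :
    SidonBound (Set.range n \ ((Finset.range k).image n : Finset ℤ)) C := by
  intro G a hG
  set f : C(UnitAddCircle, ℂ) := ∑ q ∈ G, a q • fourier q with hfdef
  have hf : f ∈ spectralSubspace (Set.range n) := Submodule.sum_mem _ fun q hq =>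
    Submodule.smul_mem _ _ (fourier_mem_spectralSubspace (hG hq).1)
  have hcoef : ∀ q ∈ G, fourierCoeffCLM q f = a q := fun q hq => by
    have h := fourierCoeffCLM_sum_smul_fourier Function.injective_id G a q
    rwa [if_pos hq] at h
  set s := G.preimage n hn.injOn with hs
  refine le_trans ?_ (hC f hf (s.sup id + 1))
  rw [← Finset.sum_congr rfl fun q hq => congrArg norm (hcoef q hq),
    ← Finset.sum_preimage n G hn.injOn (fun q => ‖fourierCoeffCLM q f‖)
      fun q hq hqn => absurd (hG hq).1 hqn]
  refine Finset.sum_le_sum_of_subset_of_nonneg (fun i hi => ?_) fun _ _ _ => norm_nonneg _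
  have h1 : i ≤ s.sup id := Finset.le_sup (f := id) hi
  have h2 : k ≤ i := by
    by_contra! hlt
    refine (hG (Finset.mem_preimage.1 hi)).2 ?_
    exact Finset.mem_coe.2 (Finset.mem_image_of_mem n (Finset.mem_range.2 hlt))
  exact Finset.mem_Ico.2 ⟨h2, by omega⟩

theorem isSidonAsymptoticallyOne_range {n : ℕ → ℤ} (hn : Function.Injective n)
    (h : Tendsto (fun k => |(n (k + 1) : ℝ) / (n k : ℝ)|) atTop atTop) :
    IsSidonAsymptoticallyOne (Set.range n) := by
  constructor
  · obtain ⟨K, hK⟩ := exists_norm_partialSum_add_sum_le hn h one_pos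
    -- Each of the first `K` coefficients costs `‖f‖`, and the tail costs `(1 + 1) ‖f‖`.
    refine ⟨K + 2, ?_⟩
    have hB := sidonBound_of_sum_Ico_le hn (k := 0) (C := K + 2) fun f hf m => ?_
    · simpa using hB
    · calc ∑ i ∈ Finset.Ico 0 (0 + m), ‖fourierCoeffCLM (n i) f‖
          ≤ ∑ i ∈ Finset.range (K + m), ‖fourierCoeffCLM (n i) f‖ := by
            refine Finset.sum_le_sum_of_subset_of_nonneg (fun i hi => ?_) fun _ _ _ => norm_nonneg _
            simp only [Finset.mem_Ico, Finset.mem_range] at hi ⊢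
            omega
        _ = ∑ i ∈ Finset.range K, ‖fourierCoeffCLM (n i) f‖ +
            ∑ i ∈ Finset.Ico K (K + m), ‖fourierCoeffCLM (n i) f‖ :=
            (Finset.sum_range_add_sum_Ico _ (Nat.le_add_right K m)).symm
        _ ≤ K * ‖f‖ + (1 + 1) * ‖f‖ := by
            refine add_le_add ?_ ((le_add_of_nonneg_left (norm_nonneg _)).trans
              (hK K le_rfl f hf m))
            simpa using Finset.sum_le_card_nsmul (Finset.range K) _ _ fun i _ =>
              norm_fourierCoeffCLM_apply_le (n i) f
        _ = (K + 2) * ‖f‖ := by ring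
  · intro ε hε
    obtain ⟨K, hK⟩ := exists_norm_partialSum_add_sum_le hn h
      (half_pos (NNReal.coe_pos.2 hε))
    refine ⟨(Finset.range K).image n, ?_⟩
    have hB : SidonBound (Set.range n \ ((Finset.range K).image n : Finset ℤ))
        ((1 + ε / 2 : ℝ≥0) : ℝ) :=
      sidonBound_of_sum_Ico_le hn fun f hf m =>
        (le_add_of_nonneg_left (norm_nonneg _)).trans (by simpa using hK K le_rfl f hf m)
    refine (iInf₂_le (1 + ε / 2) hB).trans_lt ?_
    have hlt : (1 + ε / 2 : ℝ≥0) < 1 + ε := by gcongr; exact NNReal.half_lt_self hε.ne'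
    exact_mod_cast hlt

end

/-! ### The converse: a recurring integer ratio -/

theorem fourier_mul_apply (l q : ℤ) (x : UnitAddCircle) :
    (fourier (l * q) x : ℂ) = (fourier q x : ℂ) ^ l := by
  rw [fourier_apply, fourier_apply, mul_smul, AddCircle.toCircle_zsmul (q • x), Circle.coe_zpow]

/-- Two pairs of characters with the same ratio `l ≠ 1` are never close to `ℓ₁`. -/
theorem exists_norm_two_pairs_le {l : ℤ} (hl : l ≠ 1) :
    ∃ c : ℂ, ‖c‖ = 1 ∧ ∃ M : ℝ, 0 ≤ M ∧ M < 4 ∧ ∀ q r : ℤ,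
      ‖(fourier q : C(UnitAddCircle, ℂ)) + fourier (l * q) +
        c • ((fourier r : C(UnitAddCircle, ℂ)) + fourier (l * r))‖ ≤ M := by
  have hl' : ((l - 1 : ℤ) : ℂ) ≠ 0 := by exact_mod_cast sub_ne_zero.2 hl
  obtain ⟨c, hc, hcl⟩ : ∃ c : ℂ, ‖c‖ = 1 ∧ c ^ (l - 1) = -1 := by
    refine ⟨Complex.exp ((Real.pi / (l - 1 : ℤ) : ℝ) * Complex.I),
      Complex.norm_exp_ofReal_mul_I _, ?_⟩
    rw [← Complex.exp_int_mul, ← Complex.exp_pi_mul_I]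
    congr 1
    push_cast at hl' ⊢
    field_simp
  let F : Circle × Circle → ℝ := fun p =>
    ‖((p.1 : ℂ) + (p.1 ^ l : Circle)) + c * ((p.2 : ℂ) + (p.2 ^ l : Circle))‖
  have hpow : Continuous fun w : Circle => w + ((w ^ l : Circle) : ℂ) :=
    have hcoe : Continuous fun w : Circle => (w : ℂ) := by fun_prop
    hcoe.add (hcoe.comp (continuous_zpow l))
  have hF : Continuous F := ((hpow.comp continuous_fst).add
    (continuous_const.mul (hpow.comp continuous_snd))).norm
  obtain ⟨⟨u, v⟩, -, hmax⟩ := isCompact_univ.exists_isMaxOn Set.univ_nonempty hF.continuousOn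
  refine ⟨c, hc, F (u, v), norm_nonneg _, ?_, fun q r => ?_⟩
  -- Norm 4 forces equality in every triangle inequality: `u = u ^ l`, `v = v ^ l` and `u = c v`.
  -- Then `1 = u ^ (l - 1) = c ^ (l - 1) v ^ (l - 1) = -1`.
  · by_contra! h4
    have hu : ‖(u : ℂ)‖ = 1 := u.norm_coe
    have hv : ‖(v : ℂ)‖ = 1 := v.norm_coe
    have hul : ‖((u ^ l : Circle) : ℂ)‖ = 1 := Circle.norm_coe _
    have hvl : ‖((v ^ l : Circle) : ℂ)‖ = 1 := Circle.norm_coe _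
    have h1 := norm_add_le (u : ℂ) (u ^ l : Circle)
    have h2 := norm_add_le (v : ℂ) (v ^ l : Circle)
    have h3 := norm_add_le ((u : ℂ) + (u ^ l : Circle)) (c * ((v : ℂ) + (v ^ l : Circle)))
    have h5 : ‖c * ((v : ℂ) + (v ^ l : Circle))‖ = ‖(v : ℂ) + (v ^ l : Circle)‖ := by
      rw [norm_mul, hc, one_mul]
    have h6 : (4 : ℝ) ≤ ‖((u : ℂ) + (u ^ l : Circle)) + c * ((v : ℂ) + (v ^ l : Circle))‖ := h4
    have e1 : (u : ℂ) = (u ^ l : Circle) :=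
      eq_of_norm_eq_of_norm_add_eq (by rw [hu, hul]) (by linarith)
    have e2 : (v : ℂ) = (v ^ l : Circle) :=
      eq_of_norm_eq_of_norm_add_eq (by rw [hv, hvl]) (by linarith)
    have e3 : (u : ℂ) + (u ^ l : Circle) = c * ((v : ℂ) + (v ^ l : Circle)) :=
      eq_of_norm_eq_of_norm_add_eq (by linarith) (by linarith)
    have e4 : (u : ℂ) = c * v := by
      rw [← e1, ← e2] at e3
      linear_combination e3 / 2
    have hroot : ∀ w : Circle, (w : ℂ) = (w ^ l : Circle) → (w : ℂ) ^ (l - 1) = 1 := fun w hw => by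
      rw [zpow_sub_one₀ w.coe_ne_zero, ← Circle.coe_zpow, ← hw, mul_inv_cancel₀ w.coe_ne_zero]
    have h7 := hroot u e1
    rw [e4, mul_zpow, hroot v e2, hcl] at h7
    norm_num at h7
  · refine (ContinuousMap.norm_le _ (norm_nonneg _)).2 fun x => ?_
    have h := hmax (Set.mem_univ (AddCircle.toCircle (q • x), AddCircle.toCircle (r • x)))
    simp only [ContinuousMap.add_apply, ContinuousMap.smul_apply, smul_eq_mul, fourier_mul_apply]
    simpa only [F, Set.mem_ofPred_eq, Circle.coe_zpow, fourier_apply] using h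

/-- An integer quotient that recurs, if the quotients do not tend to infinity. -/
theorem exists_frequently_eq_mul {n : ℕ → ℤ} (hn : Function.Injective n) (h0 : ∀ k, n k ≠ 0)
    (hdvd : ∀ k, n k ∣ n (k + 1))
    (h : ¬ Tendsto (fun k => |(n (k + 1) : ℝ) / (n k : ℝ)|) atTop atTop) :
    ∃ l : ℤ, l ≠ 1 ∧ ∃ᶠ k in atTop, n (k + 1) = l * n k := by
  choose d hd using hdvd
  simp only [tendsto_atTop, not_forall, not_eventually, not_le] at h
  obtain ⟨B, hB⟩ := h
  have hfin : ∃ᶠ k in atTop, ∃ l ∈ Finset.Icc (-⌈B⌉) ⌈B⌉, n (k + 1) = l * n k := by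
    refine hB.mono fun k hk => ⟨d k, ?_, by rw [hd, mul_comm]⟩
    have hnk : (n k : ℝ) ≠ 0 := by exact_mod_cast h0 k
    rw [hd, Int.cast_mul, mul_div_cancel_left₀ _ hnk] at hk
    have h2 := abs_lt.1 (hk.trans_le (Int.le_ceil B))
    rw [Finset.mem_Icc]
    exact ⟨by exact_mod_cast h2.1.le, by exact_mod_cast h2.2.le⟩
  -- Pigeonhole: finitely many candidate ratios occur infinitely often in total.
  obtain ⟨l, hl⟩ : ∃ l : ℤ, ∃ᶠ k in atTop, n (k + 1) = l * n k := by
    by_contra! hcon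
    have hall := (eventually_all_finset (Finset.Icc (-⌈B⌉) ⌈B⌉)).2 fun l _ => hcon l
    obtain ⟨k, ⟨l, hl, he⟩, hk⟩ := (hfin.and_eventually hall).exists
    exact hk l hl he
  refine ⟨l, ?_, hl⟩
  rintro rfl
  obtain ⟨k, hk⟩ := hl.exists
  rw [one_mul] at hk
  exact absurd (hn hk) (by omega)

open ContinuousWithSpectrum in
theorem not_realizes_of_frequently {n : ℕ → ℤ} (hn : Function.Injective n) {l : ℤ} (hl : l ≠ 1)
    (hfreq : ∃ᶠ k in atTop, n (k + 1) = l * n k) :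
    ¬ RealizesMetricOneAdditiveAP (naturalProj n) := by
  rintro ⟨-, hunif⟩
  obtain ⟨c, hc, M, hM0, hM4, hM⟩ := exists_norm_two_pairs_le hl
  -- With this tolerance `M (1 + ε) = 4 - (4 - M)² / 4 < 4`.
  have hε : 0 < (4 - M) / 4 := by linarith
  obtain ⟨K, hK⟩ := eventually_atTop.1 (Metric.tendstoUniformlyOn_iff.1 hunif _ hε)
  obtain ⟨j, hj, hjl⟩ := frequently_atTop.1 hfreq K
  -- From `j + 2` on, the second pair is disjoint from the first, and the projection of index `j +
  -- 1` separates them.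
  obtain ⟨k, hk, hkl⟩ := frequently_atTop.1 hfreq (j + 2)
  let e : ℕ → ContinuousWithSpectrum (Set.range n) := fun i => char (n i) (Set.mem_range_self i)
  have he : ∀ i, incl (Set.range n) (e i) = fourier (n i) := fun i => rfl
  let x := e j + e (j + 1) + c • (e k + e (k + 1))
  have hT : ∀ i, naturalProj n (j + 1) (e i) = if i < j + 2 then e i else 0 := fun i => by
    apply (incl (Set.range n)).injective
    rw [incl_naturalProj_apply, he]
    have hterm : ∀ i', fourierCoeff (fourier (n i) : C(UnitAddCircle, ℂ)) (n i') •
        (fourier (n i') : C(UnitAddCircle, ℂ)) = if i' = i then fourier (n i') else 0 :=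
      fun i' => by
        simp only [fourierCoeff_fourier, Pi.single_apply, hn.eq_iff]
        split_ifs <;> ext <;> simp
    simp only [hterm, Finset.sum_ite_eq', Finset.mem_range]
    split_ifs <;> simp_all
  have hTx : naturalProj n (j + 1) x = e j + e (j + 1) := by
    simp only [x, map_add, map_smul, hT]
    rw [if_pos (by omega), if_pos (by omega), if_neg (by omega), if_neg (by omega)]
    simp
  have hpair : ∀ i i', 2 ≤ ‖e i + e i'‖ := fun i i' => by
    rw [← (incl (Set.range n)).norm_map, map_add, he, he]
    refine le_trans ?_ (ContinuousMap.norm_coe_le_norm _ 0)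
    simp only [ContinuousMap.add_apply, fourier_eval_zero]
    norm_num
  have hxM : ‖x‖ ≤ M := by
    rw [← (incl (Set.range n)).norm_map]
    simp only [x, map_add, map_smul, he, hjl, hkl]
    exact hM _ _
  have hsum : 4 ≤ ‖x - naturalProj n (j + 1) x‖ + ‖naturalProj n (j + 1) x‖ := by
    rw [hTx, show x - (e j + e (j + 1)) = c • (e k + e (k + 1)) by simp only [x]; abel,
      norm_smul, hc, one_mul]
    linarith [hpair j (j + 1), hpair k (k + 1)]
  have hx0 : 0 < ‖x‖ := by
    rw [norm_pos_iff]
    intro h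
    rw [h] at hsum
    simp at hsum
    linarith
  let y : ContinuousWithSpectrum (Set.range n) := ((‖x‖⁻¹ : ℝ) : ℂ) • x
  have hnorm : ‖((‖x‖⁻¹ : ℝ) : ℂ)‖ = ‖x‖⁻¹ := by
    rw [Complex.norm_real, Real.norm_of_nonneg (by positivity)]
  have hy : y ∈ Metric.sphere (0 : ContinuousWithSpectrum (Set.range n)) 1 := by
    rw [mem_sphere_zero_iff_norm, norm_smul, hnorm, inv_mul_cancel₀ hx0.ne']
  have hfin := hK (j + 1) (by omega) y hy
  rw [Real.dist_eq, abs_sub_comm] at hfin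
  simp only [y, map_smul, ← smul_sub, norm_smul, hnorm, ← mul_add] at hfin
  have h1 := (abs_lt.1 hfin).2
  have h2 : ‖x‖⁻¹ * (‖x - naturalProj n (j + 1) x‖ + ‖naturalProj n (j + 1) x‖) <
      1 + (4 - M) / 4 := by linarith
  rw [inv_mul_lt_iff₀ hx0] at h2
  nlinarith

theorem exists_sidonBound_lt {S : Set ℤ} {b : ℝ≥0∞} (h : sidonConstant S < b) :
    ∃ C : ℝ≥0, SidonBound S C ∧ (C : ℝ≥0∞) < b := by
  simp only [sidonConstant, iInf_lt_iff] at h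
  obtain ⟨C, hC, hlt⟩ := h
  exact ⟨C, hC, hlt⟩

theorem not_isSidonAsymptoticallyOne_of_frequently {n : ℕ → ℤ} (hn : Function.Injective n) {l : ℤ}
    (hl : l ≠ 1) (hfreq : ∃ᶠ k in atTop, n (k + 1) = l * n k) :
    ¬ IsSidonAsymptoticallyOne (Set.range n) := by
  rintro ⟨-, has⟩
  obtain ⟨c, hc, M, hM0, hM4, hM⟩ := exists_norm_two_pairs_le hl
  obtain ⟨η, hη⟩ : ∃ η : ℝ≥0, (η : ℝ) = (4 - M) / 4 := ⟨⟨(4 - M) / 4, by linarith⟩, rfl⟩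
  obtain ⟨F, hF⟩ := has η (by rw [← NNReal.coe_pos, hη]; linarith)
  obtain ⟨C, hC, hClt⟩ := exists_sidonBound_lt hF
  have hClt' : (C : ℝ) < 1 + (4 - M) / 4 := by
    have : C < 1 + η := by exact_mod_cast hClt
    rw [← hη]
    exact_mod_cast this
  -- By injectivity only finitely many indices map into `F`, so both pairs can be chosen in `E \ F`.
  obtain ⟨K, hK⟩ : ∃ K, ∀ i, K ≤ i → n i ∉ F := by
    have := hn.tendsto_cofinite.eventually F.finite_toSet.compl_mem_cofinite
    rw [Nat.cofinite_eq_atTop] at this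
    simpa using eventually_atTop.1 this
  obtain ⟨j, hj, hjl⟩ := frequently_atTop.1 hfreq K
  obtain ⟨k, hk, hkl⟩ := frequently_atTop.1 hfreq (j + 2)
  have hsub : ((({n j, n (j + 1), n k, n (k + 1)} : Finset ℤ)) : Set ℤ) ⊆ Set.range n \ F := by
    intro q hq
    simp only [Finset.coe_insert, Finset.coe_singleton, Set.mem_insert_iff,
      Set.mem_singleton_iff] at hq
    rcases hq with rfl | rfl | rfl | rfl <;>
      exact ⟨Set.mem_range_self _, hK _ (by omega)⟩
  have hne : ∀ i i', i ≠ i' → n i ≠ n i' := fun i i' h => hn.ne h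
  have hS := hC _ (fun q => if q = n k ∨ q = n (k + 1) then c else 1) hsub
  have d1 := hne j (j + 1) (by omega)
  have d2 := hne j k (by omega)
  have d3 := hne j (k + 1) (by omega)
  have d4 := hne (j + 1) k (by omega)
  have d5 := hne (j + 1) (k + 1) (by omega)
  have d6 := hne k (k + 1) (by omega)
  simp only [Finset.sum_insert, Finset.sum_singleton, Finset.mem_insert, Finset.mem_singleton,
    d1, d2, d3, d4, d5, d6, or_self, not_false_eq_true, if_false, true_or, or_true, if_true,
    norm_one, hc, one_smul] at hS
  have hsmul : c • (fourier (n k) : C(UnitAddCircle, ℂ)) + c • fourier (n (k + 1)) =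
      c • (fourier (n k) + fourier (n (k + 1))) := by ext; simp [mul_add]
  have hassoc : (fourier (n j) : C(UnitAddCircle, ℂ)) + (fourier (n (j + 1)) +
      c • (fourier (n k) + fourier (n (k + 1)))) = fourier (n j) + fourier (n (j + 1)) +
      c • (fourier (n k) + fourier (n (k + 1))) := (add_assoc _ _ _).symm
  rw [hsmul, hassoc, hjl, hkl] at hS
  have h1 := hS.trans (mul_le_mul_of_nonneg_left (hM (n j) (n k)) C.coe_nonneg)
  nlinarith [C.coe_nonneg]

theorem theorem10p3 (n : ℕ → ℤ) (hn : Function.Injective n) :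
    (Tendsto (fun k => |(n (k + 1) : ℝ) / (n k : ℝ)|) atTop atTop →
      HasMetricOneAdditiveAP (ContinuousWithSpectrum (Set.range n)) ∧
      RealizesMetricOneAdditiveAP (naturalProj n) ∧
      IsSidonAsymptoticallyOne (Set.range n)) ∧
    ((∀ k, n k ≠ 0) → (∀ k, n k ∣ n (k + 1)) →
      (RealizesMetricOneAdditiveAP (naturalProj n) ∨ IsSidonAsymptoticallyOne (Set.range n)) →
      Tendsto (fun k => |(n (k + 1) : ℝ) / (n k : ℝ)|) atTop atTop) := by
  refine ⟨fun h => ⟨hasMetricOneAdditiveAP hn h, realizesMetricOneAdditiveAP_naturalProj hn h,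
    isSidonAsymptoticallyOne_range hn h⟩, fun h0 hdvd hor => ?_⟩
  by_contra hnot
  obtain ⟨l, hl, hfreq⟩ := exists_frequently_eq_mul hn h0 hdvd hnot
  exact hor.elim (not_realizes_of_frequently hn hl hfreq)
    (not_isSidonAsymptoticallyOne_of_frequently hn hl hfreq)
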